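/- For a positive integer $n$ let $O(n)$ be the group of real orthogonal $n\times n$ matrices. For a real matrix $Z$ write $\|Z\|_4^4=\sum_{i,j}Z_{ij}^4$, let $\|Z\|_F$ be the Frobenius norm, and let $\nabla_A\|AY\|_4^4$ be the $n\times n$ matrix of partial derivatives of $\|AY\|_4^4$ with respect to the entries of $A$. For $\theta\in(0,1)$, $\mathrm{BG}(\theta)$ denotes the law of $bg$ with $b\sim\mathrm{Ber}(\theta)$ and $g\sim\mathcal N(0,1)$ independent. There are absolute constants $C>0$ and $k\in\mathbb N$ such that for every $\delta>0$ there is a size threshold $M=M(\delta)$, with $M(\delta)\le C\,\delta^{-k}$ whenever $\delta\le 1$, such that the following holds. Let $\theta\in(0,1)$, let $n,p\ge 1$ be integers with $\max(n,p)\ge M(\delta)$ and $$p\;\ge\; C\,\frac{\theta\, n^2\ln n}{\delta^2},$$ let $X_o\in\mathbb R^{n\times p}$ be a random matrix with i.i.d. $\mathrm{BG}(\theta)$ entries, let $D_o\in O(n)$, and put $Y=D_oX_o$. Then $$\mathbb P\left(\sup_{A\in O(n)}\frac1{4np}\Big\|\nabla_A\|AY\|_4^4-\mathbb E\big[\nabla_A\|AY\|_4^4\big]\Big\|_F\ge\delta\right)<\frac1p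 .$$ -/

import Mathlib

open MeasureTheory ProbabilityTheory

-- `‖M‖` is the Frobenius norm on real matrices.
open scoped Matrix.Norms.Frobenius

noncomputable section

/-- The Bernoulli–Gaussian law `BG(θ)` on `ℝ`: the law of the product of a `Ber(θ)` variable (values
`1` and `0`, the value `1` with probability `θ`) and an independent standard normal variable. -/
def bernoulliGaussian (θ : unitInterval) : Measure ℝ :=
  ((bernoulliMeasure (1 : ℝ) 0 θ).prod (gaussianReal 0 1)).map (fun q => q.1 * q.2)

/-- `X` is a random `n × p` matrix on `(Ω, μ)` with i.i.d. entries of law `BG(θ)`. -/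
structure IsBernoulliGaussianMatrix {Ω : Type*} [MeasurableSpace Ω] {n p : ℕ}
    (X : Ω → Matrix (Fin n) (Fin p) ℝ) (θ : unitInterval) (μ : Measure Ω) : Prop where
  hasLaw : ∀ i j, HasLaw (fun ω => X ω i j) (bernoulliGaussian θ) μ
  indep : iIndepFun (fun (e : Fin n × Fin p) ω => X ω e.1 e.2) μ

/-- The fourth power `∑ i j, (M i j) ^ 4` of the entrywise `ℓ⁴` norm of a matrix. -/
def l4Pow {n p : ℕ} (M : Matrix (Fin n) (Fin p) ℝ) : ℝ :=
  ∑ i, ∑ j, M i j ^ 4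

/-- The gradient at `A` of a function of an `n × n` matrix: the matrix of its partial derivatives
with respect to the entries. -/
def matrixGradient {n : ℕ} (F : Matrix (Fin n) (Fin n) ℝ → ℝ) (A : Matrix (Fin n) (Fin n) ℝ) :
    Matrix (Fin n) (Fin n) ℝ :=
  Matrix.of fun i j => lineDeriv ℝ F A (Matrix.single i j 1)

/-- The gradient `∇_A ‖A Y‖₄⁴`. -/
def gradL4 {n p : ℕ} (A : Matrix (Fin n) (Fin n) ℝ) (Y : Matrix (Fin n) (Fin p) ℝ) :
    Matrix (Fin n) (Fin n) ℝ :=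
  matrixGradient (fun B => l4Pow (B * Y)) A

/-- The entrywise expectation of a random matrix. -/
def matrixExpectation {Ω : Type*} [MeasurableSpace Ω] {n : ℕ} (μ : Measure Ω)
    (Z : Ω → Matrix (Fin n) (Fin n) ℝ) : Matrix (Fin n) (Fin n) ℝ :=
  Matrix.of fun i j => ∫ ω, Z ω i j ∂μ

end

/-! No net over the orthogonal group is needed. Write `x_j` for the columns of `X` and put `W = A *
D`. Entry `(a, b)` of the gradient is `4 ∑ j, (W x_j)_a ^ 3 (D x_j)_b`, which pairs `∑ j, x_j^{⊗4}`
with the tensor `w_a ⊗ w_a ⊗ w_a ⊗ d_b` of rows of `W` and `D`. These tensors are orthonormal, so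
Bessel's inequality bounds the Frobenius norm of the centered gradient by 4 times the norm of `S = ∑
j, (x_j^{⊗4} - E x_j^{⊗4})`. This bound does not involve `A`
(`norm_gradL4_sub_matrixExpectation_sq_le`).

It remains to bound the probability that `‖S‖ ≥ n p δ`. The squared norm splits into a diagonal
part, controlled by Chebyshev for `∑ j, ‖x_j‖ ^ 8`, and an off-diagonal part, whose second moment
reduces to that of single pairs (`measure_sum_sq_sum_sub_vectorMean_ge_le`). The inputs are the
moments `E ‖x‖ ^ 8`, `E ‖x‖ ^ 16` and `E ⟨x, x'⟩ ^ 8`, all supplied by `integral_sum_pow_le`. The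
sample size condition and the threshold make the two error terms each smaller than `1 / (2p)`
(`sample_size_bounds`, `moment_bounds`). -/

/-- All absolute moments of `f` are finite. -/
def HasAllMoments {Ω : Type*} [MeasurableSpace Ω] (f : Ω → ℝ) (μ : Measure Ω) : Prop :=
  ∀ q : ℕ, MemLp f q μ

namespace HasAllMoments

variable {Ω : Type*} [MeasurableSpace Ω] {μ : Measure Ω} {f g : Ω → ℝ}

theorem integrable (hf : HasAllMoments f μ) : Integrable f μ :=
  memLp_one_iff_integrable.1 (by exact_mod_cast hf 1)

theorem memLp_two (hf : HasAllMoments f μ) : MemLp f 2 μ := by exact_mod_cast hf 2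

theorem const [IsFiniteMeasure μ] (c : ℝ) : HasAllMoments (fun _ : Ω => c) μ :=
  fun _ => memLp_const c

theorem add (hf : HasAllMoments f μ) (hg : HasAllMoments g μ) :
    HasAllMoments (fun ω => f ω + g ω) μ := fun q => (hf q).add (hg q)

theorem sub (hf : HasAllMoments f μ) (hg : HasAllMoments g μ) :
    HasAllMoments (fun ω => f ω - g ω) μ := fun q => (hf q).sub (hg q)

theorem const_mul (hf : HasAllMoments f μ) (c : ℝ) :
    HasAllMoments (fun ω => c * f ω) μ := fun q => (hf q).const_mul c

theorem mul (hf : HasAllMoments f μ) (hg : HasAllMoments g μ) :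
    HasAllMoments (fun ω => f ω * g ω) μ := by
  intro q
  have : ENNReal.HolderTriple ((2 * q : ℕ) : ENNReal) ((2 * q : ℕ) : ENNReal) (q : ENNReal) := by
    constructor
    rcases Nat.eq_zero_or_pos q with rfl | hq
    · simp
    · have h0 : (q : ENNReal) ≠ 0 := by exact_mod_cast hq.ne'
      push_cast
      rw [ENNReal.mul_inv (by simp) (by simp), ← add_mul, ENNReal.inv_two_add_inv_two, one_mul]
  exact MemLp.mul' (hg (2 * q)) (hf (2 * q))

theorem pow [IsFiniteMeasure μ] (hf : HasAllMoments f μ) (k : ℕ) :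
    HasAllMoments (fun ω => f ω ^ k) μ := by
  induction k with
  | zero => simpa using const (μ := μ) 1
  | succ k ih => simpa [pow_succ] using ih.mul hf

theorem sum [IsFiniteMeasure μ] {ι : Type*} {s : Finset ι} {f : ι → Ω → ℝ}
    (hf : ∀ i ∈ s, HasAllMoments (f i) μ) : HasAllMoments (fun ω => ∑ i ∈ s, f i ω) μ :=
  fun q => memLp_finsetSum s fun i hi => hf i hi q

theorem prod [IsFiniteMeasure μ] {ι : Type*} {s : Finset ι} {f : ι → Ω → ℝ}
    (hf : ∀ i ∈ s, HasAllMoments (f i) μ) : HasAllMoments (fun ω => ∏ i ∈ s, f i ω) μ := by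
  classical
  induction s using Finset.induction_on with
  | empty => simpa using const (μ := μ) 1
  | insert i s his ih =>
    simp only [Finset.prod_insert his]
    exact (hf i (by simp)).mul (ih fun j hj => hf j (by simp [hj]))

end HasAllMoments

/-! ### Independence of columns and moments of independent sums -/

/-- The columns of a matrix of independent random variables are independent. -/
theorem iIndepFun_columns {Ω ι κ : Type*} [MeasurableSpace Ω] {μ : Measure Ω}
    [IsProbabilityMeasure μ] [Countable ι] [Countable κ]
    {f : ι × κ → Ω → ℝ} (hf : ∀ e, Measurable (f e)) (h : iIndepFun f μ) :
    iIndepFun (fun (i : ι) ω (j : κ) => f (i, j) ω) μ := by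
  have (i : ι) (j : κ) : IsProbabilityMeasure (μ.map (f (i, j))) :=
    Measure.isProbabilityMeasure_map (hf (i, j)).aemeasurable
  rw [iIndepFun_iff_map_fun_eq_infinitePi_map (by fun_prop)]
  have h1 := (iIndepFun_iff_map_fun_eq_infinitePi_map hf).1 h
  have h2 (i : ι) : μ.map (fun ω j => f (i, j) ω)
      = Measure.infinitePi fun j => μ.map (f (i, j)) :=
    (iIndepFun_iff_map_fun_eq_infinitePi_map fun j => hf (i, j)).1
      (h.precomp (g := fun j => (i, j)) fun a b hab => by simpa using hab)
  simp_rw [h2]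
  -- Currying turns the product law over pairs into a product of product laws.
  have h3 := Measure.infinitePi_map_curry (ι := ι) (κ := κ) (fun i j => μ.map (f (i, j)))
  rw [← h3, ← h1, Measure.map_map (by fun_prop) (by fun_prop)]
  rfl

section Moments

variable {Ω ι : Type*} [MeasurableSpace Ω] {μ : Measure Ω} [IsProbabilityMeasure μ]
  {ξ : ι → Ω → ℝ}

theorem integral_sum_insert_pow [DecidableEq ι] (hm : ∀ i, Measurable (ξ i)) (hξ : iIndepFun ξ μ)
    (hM : ∀ i, HasAllMoments (ξ i) μ) {s : Finset ι} {i : ι} (hi : i ∉ s) (K : ℕ) :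
    ∫ ω, (∑ a ∈ insert i s, ξ a ω) ^ K ∂μ
      = ∑ l ∈ Finset.range (K + 1),
          (∫ ω, (∑ a ∈ s, ξ a ω) ^ l ∂μ) * (∫ ω, ξ i ω ^ (K - l) ∂μ) * (K.choose l : ℝ) := by
  have hS : HasAllMoments (fun ω => ∑ a ∈ s, ξ a ω) μ := .sum fun a _ => hM a
  have hind : IndepFun (fun ω => ∑ a ∈ s, ξ a ω) (ξ i) μ := by
    have := hξ.indepFun_finsetSum_of_notMem hm hi
    convert this using 1
    ext ω; simp
  simp_rw [Finset.sum_insert hi, add_comm (ξ i _), add_pow]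
  rw [integral_finsetSum]
  · refine Finset.sum_congr rfl fun l _ => ?_
    rw [integral_mul_const]
    congr 1
    exact (hind.comp (φ := (· ^ l)) (ψ := (· ^ (K - l))) (by fun_prop)
      (by fun_prop)).integral_fun_mul_eq_mul_integral
      (hS.pow l).integrable.aestronglyMeasurable ((hM i).pow _).integrable.aestronglyMeasurable
  · intro l _
    exact (((hS.pow l).mul ((hM i).pow _)).integrable).mul_const _

/-- In the binomial expansion after splitting off one summand, every term contains a vanishing
moment, either of that summand or of the remaining sum. -/
theorem integral_sum_pow_eq_zero (hm : ∀ i, Measurable (ξ i)) (hξ : iIndepFun ξ μ)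
    (hM : ∀ i, HasAllMoments (ξ i) μ) {d : ℕ}
    (hlt : ∀ i l, 1 ≤ l → l < d → ∫ ω, ξ i ω ^ l ∂μ = 0)
    (l : ℕ) (hl0 : 1 ≤ l) (hld : l < d) (t : Finset ι) :
    ∫ ω, (∑ a ∈ t, ξ a ω) ^ l ∂μ = 0 := by
  classical
  induction l using Nat.strong_induction_on generalizing t with
  | _ l IH =>
  induction t using Finset.induction_on with
  | empty => simp [zero_pow (by omega : l ≠ 0)]
  | insert i t hit ih =>
    rw [integral_sum_insert_pow hm hξ hM hit]
    refine Finset.sum_eq_zero fun m hml => ?_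
    rcases Nat.eq_zero_or_pos m with rfl | hm0
    · rw [hlt i (l - 0) (by omega) (by omega)]; simp
    · rcases (by simp at hml; omega : m < l ∨ m = l) with h | rfl
      · rw [IH m h hm0 (by omega)]; simp
      · rw [ih]; simp

/-- Moments of a sum of independent variables whose moments are nonnegative, vanish below
order `d`, and are at most `τ` from order `d` on. -/
theorem integral_sum_pow_le (hm : ∀ i, Measurable (ξ i)) (hξ : iIndepFun ξ μ)
    (hM : ∀ i, HasAllMoments (ξ i) μ) (h0 : ∀ i l, 0 ≤ ∫ ω, ξ i ω ^ l ∂μ)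
    {d N K₀ : ℕ} {τ : ℝ} (hd : 1 ≤ d) (hτ : 0 ≤ τ)
    (hlt : ∀ i l, 1 ≤ l → l < d → ∫ ω, ξ i ω ^ l ∂μ = 0)
    (hle : ∀ i l, 1 ≤ l → l ≤ K₀ → ∫ ω, ξ i ω ^ l ∂μ ≤ τ)
    (s : Finset ι) (hs : s.card ≤ N) (K : ℕ) (hK : 1 ≤ K) (hK₀ : K ≤ K₀) :
    ∫ ω, (∑ a ∈ s, ξ a ω) ^ K ∂μ ≤ 2 ^ (K ^ 2) * (N * τ) * (1 + N * τ) ^ (K / d - 1) := by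
  classical
  induction K using Nat.strong_induction_on generalizing s with
  | _ K IH =>
  have hu : 0 ≤ N * τ := by positivity
  set u : ℝ := N * τ with hu_def
  -- The exponent is `l / d` rather than `l / d - 1` so that `l = 0`, where the moment is 1, is
  -- covered.
  have hlow (t : Finset ι) (ht : t.card ≤ N) (l : ℕ) (hl : l < K) :
      ∫ ω, (∑ a ∈ t, ξ a ω) ^ l ∂μ ≤ 2 ^ ((K - 1) ^ 2) * (1 + u) ^ (l / d) := by
    rcases Nat.eq_zero_or_pos l with rfl | hl0
    · simpa using one_le_pow₀ (M₀ := ℝ) (by norm_num : (1 : ℝ) ≤ 2)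
    by_cases hld : l < d
    · have hz : ∫ ω, (∑ a ∈ t, ξ a ω) ^ l ∂μ = 0 :=
        integral_sum_pow_eq_zero hm hξ hM hlt l hl0 hld t
      rw [hz]; positivity
    · refine (IH l hl t ht hl0 (by omega)).trans ?_
      have hq : 1 ≤ l / d := (Nat.one_le_div_iff (by omega)).2 (by omega)
      calc (2 : ℝ) ^ (l ^ 2) * u * (1 + u) ^ (l / d - 1)
          ≤ 2 ^ ((K - 1) ^ 2) * (1 + u) * (1 + u) ^ (l / d - 1) := by
            gcongr
            · norm_num
            · omega
            · linarith
        _ = 2 ^ ((K - 1) ^ 2) * (1 + u) ^ (l / d) := by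
            rw [mul_assoc, ← pow_succ', Nat.sub_add_cancel hq]
  -- Adding one summand costs a fixed amount. The term `l = K` is the old moment; a term `l < K` has
  -- a factor at most `τ` and vanishes unless `K - l ≥ d`, which forces `l / d ≤ K / d - 1`.
  have hstep : ∀ t : Finset ι, t.card ≤ N → ∫ ω, (∑ a ∈ t, ξ a ω) ^ K ∂μ
      ≤ t.card * (τ * (2 ^ K * (2 ^ ((K - 1) ^ 2) * (1 + u) ^ (K / d - 1)))) := by
    intro t
    induction t using Finset.induction_on with
    | empty => simp [zero_pow (by omega : K ≠ 0)]
    | insert i t hit ih =>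
      intro ht
      rw [Finset.card_insert_of_notMem hit] at ht ⊢
      rw [integral_sum_insert_pow hm hξ hM hit, Finset.sum_range_succ]
      have h1 := ih (by omega)
      have h2 : ∑ l ∈ Finset.range K, (∫ ω, (∑ a ∈ t, ξ a ω) ^ l ∂μ) *
            (∫ ω, ξ i ω ^ (K - l) ∂μ) * (K.choose l : ℝ)
          ≤ ∑ l ∈ Finset.range K, (2 ^ ((K - 1) ^ 2) * (1 + u) ^ (K / d - 1)) * τ *
            (K.choose l : ℝ) := by
        refine Finset.sum_le_sum fun l hl => ?_
        have hl' : l < K := by simpa using hl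
        refine mul_le_mul_of_nonneg_right ?_ (by positivity)
        by_cases hld : K - l < d
        · rw [hlt i (K - l) (by omega) hld]
          simp only [mul_zero]; positivity
        · refine mul_le_mul ((hlow t (by omega) l hl').trans ?_)
            (hle i (K - l) (by omega) (by omega)) (h0 i _) (by positivity)
          gcongr
          · linarith
          · have : l / d + 1 ≤ K / d := by
              rw [← Nat.add_div_right l (by omega)]
              exact Nat.div_le_div_right (by omega)
            omega
      have h3 : ∑ l ∈ Finset.range K, (K.choose l : ℝ) ≤ 2 ^ K := by
        have := Nat.sum_range_choose K
        rw [Finset.sum_range_succ] at this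
        have h4 : ∑ l ∈ Finset.range K, K.choose l ≤ 2 ^ K := by omega
        exact_mod_cast h4
      rw [← Finset.mul_sum] at h2
      have h4 := mul_le_mul_of_nonneg_left h3
        (show 0 ≤ (2 ^ ((K - 1) ^ 2) * (1 + u) ^ (K / d - 1)) * τ by positivity)
      simp only [Nat.sub_self, pow_zero, integral_const, probReal_univ, smul_eq_mul, mul_one,
        Nat.choose_self, Nat.cast_one]
      push_cast
      nlinarith
  refine (hstep s hs).trans ?_
  have hpow : (2 : ℝ) ^ K * 2 ^ ((K - 1) ^ 2) ≤ 2 ^ (K ^ 2) := by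
    rw [← pow_add]
    refine pow_le_pow_right₀ (by norm_num) ?_
    obtain ⟨m, rfl⟩ : ∃ m, K = m + 1 := ⟨K - 1, by omega⟩
    simp only [Nat.add_sub_cancel]
    nlinarith
  have hcard : (s.card : ℝ) ≤ N := by exact_mod_cast hs
  calc (s.card : ℝ) * (τ * (2 ^ K * (2 ^ ((K - 1) ^ 2) * (1 + u) ^ (K / d - 1))))
      = (s.card * τ) * ((2 ^ K * 2 ^ ((K - 1) ^ 2)) * (1 + u) ^ (K / d - 1)) := by ring
    _ ≤ (N * τ) * (2 ^ (K ^ 2) * (1 + u) ^ (K / d - 1)) := by gcongr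
    _ = _ := by rw [hu_def]; ring

end Moments

/-! ### Moments of the Bernoulli–Gaussian law and of its columns -/

theorem bernoulliGaussian_eq (θ : unitInterval) :
    bernoulliGaussian θ = unitInterval.toNNReal θ • gaussianReal 0 1
      + unitInterval.toNNReal (unitInterval.symm θ) • Measure.dirac 0 := by
  have h1 : ((Measure.dirac (1 : ℝ)).prod (gaussianReal 0 1)).map (fun q : ℝ × ℝ => q.1 * q.2)
      = gaussianReal 0 1 := by
    rw [Measure.dirac_prod, Measure.map_map (by fun_prop) (by fun_prop)]
    convert Measure.map_id using 2
    ext; simp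
  have h0 : ((Measure.dirac (0 : ℝ)).prod (gaussianReal 0 1)).map (fun q : ℝ × ℝ => q.1 * q.2)
      = Measure.dirac 0 := by
    rw [Measure.dirac_prod, Measure.map_map (by fun_prop) (by fun_prop)]
    have : ((fun q : ℝ × ℝ => q.1 * q.2) ∘ Prod.mk 0) = fun _ => (0 : ℝ) := by
      ext; simp
    rw [this, Measure.map_const]; simp
  rw [bernoulliGaussian, bernoulliMeasure_def, Measure.add_prod, Measure.map_add _ _ (by fun_prop)]
  have hs (c : NNReal) (ν : Measure ℝ) [SFinite ν] : (c • ν).prod (gaussianReal 0 1)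
      = c • (ν.prod (gaussianReal 0 1)) := Measure.prod_smul_left (c : ENNReal)
  rw [hs, hs, Measure.map_smul, Measure.map_smul, h1, h0]

/-- The moments of the standard normal law. -/
noncomputable def gaussianMoment (l : ℕ) : ℝ := ∫ x, x ^ l ∂(gaussianReal 0 1)

theorem hasAllMoments_gaussianReal : HasAllMoments (fun x : ℝ => x) (gaussianReal 0 1) :=
  fun q => memLp_id_gaussianReal (q : NNReal)

theorem gaussianMoment_of_odd {l : ℕ} (hl : Odd l) : gaussianMoment l = 0 := by
  have h : ∫ x, x ^ l ∂((gaussianReal 0 1).map (fun x => -x)) = -gaussianMoment l := by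
    rw [integral_map (by fun_prop) (by fun_prop), gaussianMoment, ← integral_neg]
    simp [hl.neg_pow]
  rw [gaussianReal_map_neg, neg_zero, ← gaussianMoment] at h
  linarith

theorem gaussianMoment_nonneg (l : ℕ) : 0 ≤ gaussianMoment l := by
  rcases Nat.even_or_odd l with h | h
  · exact integral_nonneg fun x => h.pow_nonneg x
  · rw [gaussianMoment_of_odd h]

theorem hasAllMoments_bernoulliGaussian (θ : unitInterval) :
    HasAllMoments (fun x : ℝ => x) (bernoulliGaussian θ) := by
  intro q
  rcases Nat.eq_zero_or_pos q with rfl | hq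
  · exact ⟨by fun_prop, by simp⟩
  have hq' : (q : ENNReal) ≠ 0 := by exact_mod_cast hq.ne'
  rw [← integrable_norm_rpow_iff (by fun_prop) hq' (by simp), bernoulliGaussian_eq]
  refine Integrable.add_measure ?_ ?_
  · exact ((integrable_norm_rpow_iff (by fun_prop) hq' (by simp)).2
      (hasAllMoments_gaussianReal q)).smul_measure ENNReal.coe_ne_top
  · exact (integrable_dirac (by simp)).smul_measure ENNReal.coe_ne_top

theorem integral_pow_bernoulliGaussian (θ : unitInterval) {l : ℕ} (hl : l ≠ 0) :
    ∫ x, x ^ l ∂(bernoulliGaussian θ) = θ * gaussianMoment l := by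
  rw [bernoulliGaussian_eq, integral_add_measure]
  · rw [integral_smul_nnreal_measure, integral_smul_nnreal_measure]
    simp [hl, gaussianMoment, NNReal.smul_def]
  · exact (hasAllMoments_gaussianReal.pow l).integrable.smul_measure ENNReal.coe_ne_top
  · exact (integrable_dirac (by simp)).smul_measure ENNReal.coe_ne_top

/-- A common bound on the first sixteen moments of the standard normal law and their squares. -/
noncomputable def momentBound : ℝ :=
  1 + ∑ l ∈ Finset.range 17, (gaussianMoment l + gaussianMoment l ^ 2)

theorem one_le_momentBound : 1 ≤ momentBound := by
  have : 0 ≤ ∑ l ∈ Finset.range 17, (gaussianMoment l + gaussianMoment l ^ 2) :=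
    Finset.sum_nonneg fun l _ => by
      have := gaussianMoment_nonneg l
      positivity
  rw [momentBound]; linarith

theorem gaussianMoment_add_sq_le {l : ℕ} (hl : l ≤ 16) :
    gaussianMoment l + gaussianMoment l ^ 2 ≤ momentBound := by
  have h := Finset.single_le_sum (f := fun l => gaussianMoment l + gaussianMoment l ^ 2)
    (fun l _ => by
      have := gaussianMoment_nonneg l
      positivity) (Finset.mem_range.2 (by omega : l < 17))
  rw [momentBound]; linarith

theorem gaussianMoment_le {l : ℕ} (hl : l ≤ 16) : gaussianMoment l ≤ momentBound := by
  nlinarith [gaussianMoment_add_sq_le hl, sq_nonneg (gaussianMoment l)]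

theorem gaussianMoment_sq_le {l : ℕ} (hl : l ≤ 16) : gaussianMoment l ^ 2 ≤ momentBound := by
  nlinarith [gaussianMoment_add_sq_le hl, gaussianMoment_nonneg l]

namespace IsBernoulliGaussianMatrix

variable {Ω : Type*} [MeasurableSpace Ω] {μ : Measure Ω} {n p : ℕ}
  {X : Ω → Matrix (Fin n) (Fin p) ℝ} {θ : unitInterval}

theorem hasAllMoments (hX : IsBernoulliGaussianMatrix X θ μ) (i : Fin n) (j : Fin p) :
    HasAllMoments (fun ω => X ω i j) μ := by
  intro q
  have h := hasAllMoments_bernoulliGaussian θ q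
  rw [← (hX.hasLaw i j).map_eq] at h
  exact (memLp_map_measure_iff h.1 (hX.hasLaw i j).aemeasurable).1 h

theorem integral_pow (hX : IsBernoulliGaussianMatrix X θ μ) (i : Fin n) (j : Fin p) {l : ℕ}
    (hl : l ≠ 0) : ∫ ω, X ω i j ^ l ∂μ = θ * gaussianMoment l := by
  rw [← integral_pow_bernoulliGaussian θ hl]
  exact (hX.hasLaw i j).integral_comp (f := fun x => x ^ l) (by fun_prop)

theorem congr (hX : IsBernoulliGaussianMatrix X θ μ) {X' : Ω → Matrix (Fin n) (Fin p) ℝ}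
    (h : ∀ i j, (fun ω => X ω i j) =ᵐ[μ] fun ω => X' ω i j) :
    IsBernoulliGaussianMatrix X' θ μ where
  hasLaw i j := (hX.hasLaw i j).congr (h i j).symm
  indep := hX.indep.congr fun e => h e.1 e.2

theorem indep_columns [IsProbabilityMeasure μ] (hX : IsBernoulliGaussianMatrix X θ μ)
    (hm : ∀ i j, Measurable fun ω => X ω i j) : iIndepFun (fun j ω i => X ω i j) μ :=
  iIndepFun_columns (f := fun e : Fin p × Fin n => fun ω => X ω e.2 e.1) (fun _ => hm _ _)
    (hX.indep.precomp (g := Prod.swap) Prod.swap_injective)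

theorem indep_rows [IsProbabilityMeasure μ] (hX : IsBernoulliGaussianMatrix X θ μ)
    (hm : ∀ i j, Measurable fun ω => X ω i j) : iIndepFun (fun i ω j => X ω i j) μ :=
  iIndepFun_columns (f := fun e : Fin n × Fin p => fun ω => X ω e.1 e.2) (fun _ => hm _ _)
    hX.indep

theorem integral_norm_sq_column_pow_le [IsProbabilityMeasure μ]
    (hX : IsBernoulliGaussianMatrix X θ μ)
    (hm : ∀ i j, Measurable fun ω => X ω i j) (j : Fin p) {K : ℕ} (hK : 1 ≤ K) (hK' : K ≤ 8) :
    ∫ ω, (∑ i, X ω i j ^ 2) ^ K ∂μ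
      ≤ 2 ^ (K ^ 2) * (n * (momentBound * θ)) * (1 + n * (momentBound * θ)) ^ (K - 1) := by
  have hB := one_le_momentBound
  have hθ := θ.2.1
  have hpow (i : Fin n) (l : ℕ) : ∫ ω, (X ω i j ^ 2) ^ l ∂μ = ∫ ω, X ω i j ^ (2 * l) ∂μ := by
    simp_rw [← pow_mul]
  -- Squares are not centered, hence `d = 1`; their eighth moments are the sixteenth moments of the
  -- entries.
  have := integral_sum_pow_le (μ := μ) (ξ := fun i ω => X ω i j ^ 2) (d := 1) (N := n) (K₀ := 8)
    (τ := momentBound * θ) (fun i => (hm i j).pow_const 2)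
    ((hX.indep_rows hm).comp (fun _ v => v j ^ 2) (fun _ => by fun_prop))
    (fun i => (hX.hasAllMoments i j).pow 2)
    (fun i l => integral_nonneg fun ω => by positivity) le_rfl (by positivity)
    (fun i l h1 h2 => by omega)
    (fun i l h1 h2 => by
      rw [hpow, hX.integral_pow i j (by omega), mul_comm]
      exact mul_le_mul_of_nonneg_right (gaussianMoment_le (by omega)) hθ)
    Finset.univ (by simp) K hK hK'
  simpa using this

theorem integral_inner_columns_pow_le [IsProbabilityMeasure μ]
    (hX : IsBernoulliGaussianMatrix X θ μ)
    (hm : ∀ i j, Measurable fun ω => X ω i j) {j k : Fin p} (hjk : j ≠ k) :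
    ∫ ω, (∑ i, X ω i j * X ω i k) ^ 8 ∂μ
      ≤ 2 ^ 64 * (n * (momentBound * θ ^ 2)) * (1 + n * (momentBound * θ ^ 2)) ^ 3 := by
  have hB := one_le_momentBound
  have hpow (i : Fin n) {l : ℕ} (hl : l ≠ 0) :
      ∫ ω, (X ω i j * X ω i k) ^ l ∂μ = θ ^ 2 * gaussianMoment l ^ 2 := by
    have hind : IndepFun (fun ω => X ω i j) (fun ω => X ω i k) μ :=
      hX.indep.indepFun (i := (i, j)) (j := (i, k)) (by simpa using hjk)
    simp_rw [mul_pow]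
    have hmul := (hind.comp (φ := (· ^ l)) (ψ := (· ^ l)) (by fun_prop)
      (by fun_prop)).integral_fun_mul_eq_mul_integral
      (((hX.hasAllMoments i j).pow l).integrable.aestronglyMeasurable)
      (((hX.hasAllMoments i k).pow l).integrable.aestronglyMeasurable)
    simp only [Function.comp_apply] at hmul
    refine hmul.trans ?_
    rw [hX.integral_pow i j hl, hX.integral_pow i k hl]
    ring
  -- Products of independent entries are centered, so `d = 2` and the last exponent is `8 / 2 - 1 =
  -- 3`. Both factors must be nonzero, which gives `θ ^ 2` in place of `θ`.
  have := integral_sum_pow_le (μ := μ) (ξ := fun i ω => X ω i j * X ω i k) (d := 2) (N := n)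
    (K₀ := 8) (τ := momentBound * θ ^ 2) (fun i => (hm i j).mul (hm i k))
    ((hX.indep_rows hm).comp (fun _ v => v j * v k) (fun _ => by fun_prop))
    (fun i => (hX.hasAllMoments i j).mul (hX.hasAllMoments i k))
    (fun i l => by
      rcases eq_or_ne l 0 with rfl | hl
      · simp
      · rw [hpow i hl]; positivity) (by norm_num) (by positivity)
    (fun i l h1 h2 => by
      obtain rfl : l = 1 := by omega
      rw [hpow i one_ne_zero, gaussianMoment_of_odd odd_one]; simp)
    (fun i l h1 h2 => by
      rw [hpow i (by omega), mul_comm]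
      exact mul_le_mul_of_nonneg_right (gaussianMoment_sq_le (by omega)) (by positivity))
    Finset.univ (by simp) 8 (by norm_num) le_rfl
  simpa using this

end IsBernoulliGaussianMatrix

/-! ### Tail bound for the norm of a sum of independent vectors -/

section QuadraticForms

variable {Ω A κ : Type*} [MeasurableSpace Ω] {μ : Measure Ω}

theorem measure_abs_ge_le [IsFiniteMeasure μ] {f : Ω → ℝ} (hf : Integrable (fun ω => f ω ^ 2) μ)
    {c : ℝ} (hc : 0 < c) : μ {ω | c ≤ |f ω|} ≤ ENNReal.ofReal ((∫ ω, f ω ^ 2 ∂μ) / c ^ 2) := by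
  have h := mul_meas_ge_le_integral_of_nonneg (ae_of_all μ fun ω => sq_nonneg (f ω)) hf (c ^ 2)
  have hset : {ω | c ≤ |f ω|} = {ω | c ^ 2 ≤ f ω ^ 2} := by
    ext ω
    simp only [Set.mem_ofPred_eq]
    rw [← sq_abs (f ω)]
    exact (pow_le_pow_iff_left₀ hc.le (abs_nonneg _) two_ne_zero).symm
  rw [hset, ← ENNReal.ofReal_toReal (measure_ne_top μ {ω | c ^ 2 ≤ f ω ^ 2})]
  refine ENNReal.ofReal_le_ofReal ?_
  rw [le_div_iff₀ (by positivity), mul_comm]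
  exact h

theorem integral_sq_inner_of_indepFun [Fintype A] [IsProbabilityMeasure μ] {Y Y' : Ω → A → ℝ}
    (h : IndepFun Y Y' μ) (hY : ∀ a, HasAllMoments (fun ω => Y ω a) μ)
    (hY' : ∀ a, HasAllMoments (fun ω => Y' ω a) μ) :
    ∫ ω, (∑ a, Y ω a * Y' ω a) ^ 2 ∂μ
      = ∑ a, ∑ b, (∫ ω, Y ω a * Y ω b ∂μ) * (∫ ω, Y' ω a * Y' ω b ∂μ) := by
  have hexp (ω : Ω) : (∑ a, Y ω a * Y' ω a) ^ 2
      = ∑ a, ∑ b, (Y ω a * Y ω b) * (Y' ω a * Y' ω b) := by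
    rw [sq, Finset.sum_mul_sum]
    exact Finset.sum_congr rfl fun a _ => Finset.sum_congr rfl fun b _ => by ring
  have hi (a b : A) : Integrable (fun ω => (Y ω a * Y ω b) * (Y' ω a * Y' ω b)) μ :=
    (((hY a).mul (hY b)).mul ((hY' a).mul (hY' b))).integrable
  simp_rw [hexp]
  rw [integral_finsetSum _ fun a _ => integrable_finsetSum _ fun b _ => hi a b]
  refine Finset.sum_congr rfl fun a _ => ?_
  rw [integral_finsetSum _ fun b _ => hi a b]
  refine Finset.sum_congr rfl fun b _ => ?_
  exact (h.comp (φ := fun v : A → ℝ => v a * v b) (ψ := fun v : A → ℝ => v a * v b) (by fun_prop)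
    (by fun_prop)).integral_fun_mul_eq_mul_integral
    ((hY a).mul (hY b)).integrable.aestronglyMeasurable
    ((hY' a).mul (hY' b)).integrable.aestronglyMeasurable

/-- The expectation of a random vector, coordinate by coordinate. -/
noncomputable def vectorMean (μ : Measure Ω) (Y : Ω → A → ℝ) (a : A) : ℝ := ∫ ω, Y ω a ∂μ

theorem hasAllMoments_sub_vectorMean [IsProbabilityMeasure μ] {Y : Ω → A → ℝ}
    (hY : ∀ a, HasAllMoments (fun ω => Y ω a) μ) (a : A) :
    HasAllMoments (fun ω => (Y ω - vectorMean μ Y) a) μ :=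
  (hY a).sub (.const _)

theorem integral_sub_vectorMean [IsProbabilityMeasure μ] {Y : Ω → A → ℝ}
    (hY : ∀ a, HasAllMoments (fun ω => Y ω a) μ) (a : A) :
    ∫ ω, (Y ω - vectorMean μ Y) a ∂μ = 0 := by
  simp only [Pi.sub_apply]
  rw [integral_sub (hY a).integrable (integrable_const _)]
  simp [vectorMean]

theorem integral_mul_sub_vectorMean [IsProbabilityMeasure μ] {Y : Ω → A → ℝ}
    (hY : ∀ a, HasAllMoments (fun ω => Y ω a) μ) (a b : A) :
    ∫ ω, (Y ω - vectorMean μ Y) a * (Y ω - vectorMean μ Y) b ∂μ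
      = (∫ ω, Y ω a * Y ω b ∂μ) - vectorMean μ Y a * vectorMean μ Y b := by
  have hexp (ω : Ω) : (Y ω - vectorMean μ Y) a * (Y ω - vectorMean μ Y) b
      = (Y ω a * Y ω b - vectorMean μ Y b * (Y ω - vectorMean μ Y) a)
        - vectorMean μ Y a * Y ω b := by
    simp only [Pi.sub_apply]; ring
  have hc := hasAllMoments_sub_vectorMean hY a
  simp_rw [hexp]
  rw [integral_sub (((hY a).mul (hY b)).sub (hc.const_mul _)).integrable
    ((hY b).const_mul _).integrable, integral_sub ((hY a).mul (hY b)).integrable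
    (hc.const_mul _).integrable, integral_const_mul, integral_const_mul,
    integral_sub_vectorMean hY]
  simp [vectorMean]

variable [Fintype A]

/-- The quadratic form is the second moment of the centered variable `⟨v, Y - E Y⟩`. -/
theorem sum_covariance_mul_nonneg [IsProbabilityMeasure μ] {Y : Ω → A → ℝ}
    (hY : ∀ a, HasAllMoments (fun ω => Y ω a) μ) (v : A → ℝ) :
    0 ≤ ∑ a, ∑ b, ((∫ ω, Y ω a * Y ω b ∂μ) - vectorMean μ Y a * vectorMean μ Y b)
      * (v a * v b) := by
  have hc := hasAllMoments_sub_vectorMean hY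
  have h : ∫ ω, (∑ a, v a * (Y ω - vectorMean μ Y) a) ^ 2 ∂μ
      = ∑ a, ∑ b, ((∫ ω, Y ω a * Y ω b ∂μ) - vectorMean μ Y a * vectorMean μ Y b)
        * (v a * v b) := by
    have hexp (ω : Ω) : (∑ a, v a * (Y ω - vectorMean μ Y) a) ^ 2
        = ∑ a, ∑ b, ((Y ω - vectorMean μ Y) a * (Y ω - vectorMean μ Y) b) * (v a * v b) := by
      rw [sq, Finset.sum_mul_sum]
      exact Finset.sum_congr rfl fun a _ => Finset.sum_congr rfl fun b _ => by ring
    have hi (a b : A) : Integrable (fun ω =>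
        ((Y ω - vectorMean μ Y) a * (Y ω - vectorMean μ Y) b) * (v a * v b)) μ :=
      ((hc a).mul (hc b)).integrable.mul_const _
    simp_rw [hexp]
    rw [integral_finsetSum _ fun a _ => integrable_finsetSum _ fun b _ => hi a b]
    refine Finset.sum_congr rfl fun a _ => ?_
    rw [integral_finsetSum _ fun b _ => hi a b]
    refine Finset.sum_congr rfl fun b _ => ?_
    rw [integral_mul_const, integral_mul_sub_vectorMean hY]
  rw [← h]
  exact integral_nonneg fun ω => sq_nonneg _

/-- Centering two independent vectors does not increase the second moment of their inner
product. -/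
theorem integral_sq_inner_sub_vectorMean_le [IsProbabilityMeasure μ] {Y Y' : Ω → A → ℝ}
    (h : IndepFun Y Y' μ) (hY : ∀ a, HasAllMoments (fun ω => Y ω a) μ)
    (hY' : ∀ a, HasAllMoments (fun ω => Y' ω a) μ) :
    ∫ ω, (∑ a, (Y ω - vectorMean μ Y) a * (Y' ω - vectorMean μ Y') a) ^ 2 ∂μ
      ≤ ∫ ω, (∑ a, Y ω a * Y' ω a) ^ 2 ∂μ := by
  have hc : IndepFun (fun ω => Y ω - vectorMean μ Y) (fun ω => Y' ω - vectorMean μ Y') μ :=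
    h.comp (φ := fun v => v - vectorMean μ Y) (ψ := fun v => v - vectorMean μ Y')
      (by fun_prop) (by fun_prop)
  rw [integral_sq_inner_of_indepFun hc (hasAllMoments_sub_vectorMean hY)
    (hasAllMoments_sub_vectorMean hY'), integral_sq_inner_of_indepFun h hY hY']
  simp_rw [integral_mul_sub_vectorMean hY, integral_mul_sub_vectorMean hY']
  -- With covariances `Σ, Σ'` and means `m, m'`, the second moment matrices are `Σ + m mᵀ` and `Σ' +
  -- m' m'ᵀ`. The difference of the two sides is `m'ᵀ Σ m' + mᵀ Σ' m + ⟨m, m'⟩ ^ 2`, a sum of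
  -- nonnegative terms.
  set m := vectorMean μ Y
  set m' := vectorMean μ Y'
  have h1 := sum_covariance_mul_nonneg hY m'
  have h2 := sum_covariance_mul_nonneg hY' m
  have h3 : 0 ≤ ∑ a, ∑ b, (m a * m' a) * (m b * m' b) := by
    rw [← Finset.sum_mul_sum]; exact mul_self_nonneg _
  rw [← sub_nonneg]
  refine (add_nonneg (add_nonneg h1 h2) h3).trans_eq ?_
  simp only [← Finset.sum_add_distrib, ← Finset.sum_sub_distrib]
  exact Finset.sum_congr rfl fun a _ => Finset.sum_congr rfl fun b _ => by ring

variable {W : κ → Ω → A → ℝ}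

/-- The index `m` occurs only once, so its mean-zero vector factors out by independence;
coincidences among the other three indices are harmless. -/
theorem integral_inner_mul_inner_eq_zero [IsProbabilityMeasure μ] [DecidableEq κ]
    (hind : iIndepFun W μ) (hm : ∀ j, Measurable (W j))
    (hM : ∀ j a, HasAllMoments (fun ω => W j ω a) μ) (h0 : ∀ j a, ∫ ω, W j ω a ∂μ = 0)
    {m k j' k' : κ} (hk : m ≠ k) (hj' : m ≠ j') (hk' : m ≠ k') :
    ∫ ω, (∑ a, W m ω a * W k ω a) * (∑ a, W j' ω a * W k' ω a) ∂μ = 0 := by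
  have hexp (ω : Ω) : (∑ a, W m ω a * W k ω a) * (∑ a, W j' ω a * W k' ω a)
      = ∑ a, ∑ b, W m ω a * (W k ω a * (W j' ω b * W k' ω b)) := by
    rw [Finset.sum_mul_sum]
    exact Finset.sum_congr rfl fun a _ => Finset.sum_congr rfl fun b _ => by ring
  have hr (a b : A) : HasAllMoments (fun ω => W k ω a * (W j' ω b * W k' ω b)) μ :=
    (hM k a).mul ((hM j' b).mul (hM k' b))
  have hi (a b : A) : Integrable (fun ω => W m ω a * (W k ω a * (W j' ω b * W k' ω b))) μ :=
    ((hM m a).mul (hr a b)).integrable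
  simp_rw [hexp]
  rw [integral_finsetSum _ fun a _ => integrable_finsetSum _ fun b _ => hi a b]
  refine Finset.sum_eq_zero fun a _ => ?_
  rw [integral_finsetSum _ fun b _ => hi a b]
  refine Finset.sum_eq_zero fun b _ => ?_
  have hd := hind.indepFun_finset {m} {k, j', k'} (by simp [hk, hj', hk']) hm
  have := (hd.comp (φ := fun v : ({m} : Finset κ) → A → ℝ => v ⟨m, by simp⟩ a)
    (ψ := fun v : ({k, j', k'} : Finset κ) → A → ℝ =>
      v ⟨k, by simp⟩ a * (v ⟨j', by simp⟩ b * v ⟨k', by simp⟩ b))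
    (by fun_prop) (by fun_prop)).integral_fun_mul_eq_mul_integral
    (hM m a).integrable.aestronglyMeasurable (hr a b).integrable.aestronglyMeasurable
  refine this.trans ?_
  simp only [Function.comp_def]
  rw [h0 m a, zero_mul]

/-- Second moment of the off-diagonal part of the squared norm of a sum of independent centered
vectors. -/
theorem integral_sq_sum_offDiag_le [IsProbabilityMeasure μ] [DecidableEq κ] [Fintype κ]
    (hind : iIndepFun W μ) (hm : ∀ j, Measurable (W j))
    (hM : ∀ j a, HasAllMoments (fun ω => W j ω a) μ) (h0 : ∀ j a, ∫ ω, W j ω a ∂μ = 0)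
    {Q : ℝ} (hQ : 0 ≤ Q) (hQW : ∀ j k, j ≠ k → ∫ ω, (∑ a, W j ω a * W k ω a) ^ 2 ∂μ ≤ Q) :
    ∫ ω, (∑ e ∈ (Finset.univ : Finset κ).offDiag, ∑ a, W e.1 ω a * W e.2 ω a) ^ 2 ∂μ
      ≤ 2 * (Fintype.card κ : ℝ) ^ 2 * Q := by
  have hh (e : κ × κ) : HasAllMoments (fun ω => ∑ a, W e.1 ω a * W e.2 ω a) μ :=
    .sum fun a _ => (hM e.1 a).mul (hM e.2 a)
  have hi (e e' : κ × κ) : Integrable (fun ω =>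
      (∑ a, W e.1 ω a * W e.2 ω a) * (∑ a, W e'.1 ω a * W e'.2 ω a)) μ :=
    ((hh e).mul (hh e')).integrable
  have hexp (ω : Ω) :
      (∑ e ∈ (Finset.univ : Finset κ).offDiag, ∑ a, W e.1 ω a * W e.2 ω a) ^ 2
        = ∑ e ∈ (Finset.univ : Finset κ).offDiag, ∑ e' ∈ (Finset.univ : Finset κ).offDiag,
          (∑ a, W e.1 ω a * W e.2 ω a) * (∑ a, W e'.1 ω a * W e'.2 ω a) := by
    rw [sq, Finset.sum_mul_sum]
  simp_rw [hexp]
  rw [integral_finsetSum _ fun e _ => integrable_finsetSum _ fun e' _ => hi e e']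
  have hsym (j k : κ) (ω : Ω) : ∑ a, W j ω a * W k ω a = ∑ a, W k ω a * W j ω a :=
    Finset.sum_congr rfl fun a _ => mul_comm _ _
  -- Only equal or swapped pairs correlate, since otherwise some index occurs exactly once. Hence
  -- each `e` contributes at most `2 * Q`.
  have hterm (e e' : κ × κ) (he : e.1 ≠ e.2) :
      ∫ ω, (∑ a, W e.1 ω a * W e.2 ω a) * (∑ a, W e'.1 ω a * W e'.2 ω a) ∂μ
        ≤ (if e' = e then Q else 0) + (if e' = e.swap then Q else 0) := by
    by_cases h1 : e.1 = e'.1 ∨ e.1 = e'.2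
    · by_cases h2 : e.2 = e'.1 ∨ e.2 = e'.2
      · have hcase : e' = e ∨ e' = e.swap := by
          obtain ⟨j, k⟩ := e
          obtain ⟨j', k'⟩ := e'
          simp only [Prod.mk.injEq, Prod.swap_prod_mk] at *
          grind
        have hval : ∫ ω, (∑ a, W e.1 ω a * W e.2 ω a) * (∑ a, W e'.1 ω a * W e'.2 ω a) ∂μ
            ≤ Q := by
          refine le_trans (le_of_eq ?_) (hQW e.1 e.2 he)
          refine integral_congr_ae (ae_of_all _ fun ω => ?_)
          rcases hcase with rfl | rfl
          · simp only [sq]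
          · simp only [sq, Prod.fst_swap, Prod.snd_swap]
            rw [hsym e.2 e.1]
        refine hval.trans ?_
        rcases hcase with h | h
        · rw [if_pos h]; split_ifs <;> linarith
        · rw [if_pos h]; split_ifs <;> linarith
      · push Not at h2
        have := integral_inner_mul_inner_eq_zero hind hm hM h0 he.symm h2.1 h2.2
        simp_rw [hsym e.1 e.2]
        rw [this]
        split_ifs <;> linarith
    · push Not at h1
      rw [integral_inner_mul_inner_eq_zero hind hm hM h0 he h1.1 h1.2]
      split_ifs <;> linarith
  calc ∑ e ∈ (Finset.univ : Finset κ).offDiag, ∫ ω, ∑ e' ∈ (Finset.univ : Finset κ).offDiag,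
        (∑ a, W e.1 ω a * W e.2 ω a) * (∑ a, W e'.1 ω a * W e'.2 ω a) ∂μ
      ≤ ∑ _e ∈ (Finset.univ : Finset κ).offDiag, 2 * Q := by
        refine Finset.sum_le_sum fun e he => ?_
        rw [integral_finsetSum _ fun e' _ => hi e e']
        refine (Finset.sum_le_sum fun e' _ => hterm e e' (by simpa using he)).trans ?_
        rw [Finset.sum_add_distrib, Finset.sum_ite_eq', Finset.sum_ite_eq']
        split_ifs <;> linarith
    _ ≤ 2 * (Fintype.card κ : ℝ) ^ 2 * Q := by
        rw [Finset.sum_const, nsmul_eq_mul, Finset.offDiag_card]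
        have : ((Finset.univ : Finset κ).card * (Finset.univ : Finset κ).card
            - (Finset.univ : Finset κ).card : ℕ) ≤ Fintype.card κ ^ 2 := by
          rw [Finset.card_univ, sq]; omega
        have h' : (((Finset.univ : Finset κ).card * (Finset.univ : Finset κ).card
            - (Finset.univ : Finset κ).card : ℕ) : ℝ) ≤ (Fintype.card κ : ℝ) ^ 2 := by
          exact_mod_cast this
        nlinarith

theorem sum_sq_sum_eq [DecidableEq κ] [Fintype κ] (v : κ → A → ℝ) :
    ∑ a, (∑ j, v j a) ^ 2 = ∑ j, ∑ a, v j a ^ 2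
      + ∑ e ∈ (Finset.univ : Finset κ).offDiag, ∑ a, v e.1 a * v e.2 a := by
  have h1 : ∑ a, (∑ j, v j a) ^ 2
      = ∑ e ∈ (Finset.univ : Finset κ) ×ˢ (Finset.univ : Finset κ), ∑ a, v e.1 a * v e.2 a := by
    rw [Finset.sum_comm]
    refine Finset.sum_congr rfl fun a _ => ?_
    rw [sq, Finset.sum_mul_sum, Finset.sum_product]
  rw [h1, ← Finset.diag_union_offDiag, Finset.sum_union (Finset.disjoint_diag_offDiag _),
    Finset.sum_diag]
  simp [sq]

/-- Tail bound for the norm of a sum of independent centered vectors. -/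
theorem measure_sum_sq_sum_sub_vectorMean_ge_le [IsProbabilityMeasure μ] [Fintype κ]
    (hind : iIndepFun W μ) (hm : ∀ j, Measurable (W j))
    (hM : ∀ j a, HasAllMoments (fun ω => W j ω a) μ)
    {r ρ Q t : ℝ} (hQ : 0 ≤ Q) (ht : 0 < t)
    (hr : ∀ j, ∫ ω, ∑ a, W j ω a ^ 2 ∂μ ≤ r)
    (hρ : ∀ j, ∫ ω, (∑ a, W j ω a ^ 2) ^ 2 ∂μ ≤ ρ)
    (hQW : ∀ j k, j ≠ k → ∫ ω, (∑ a, W j ω a * W k ω a) ^ 2 ∂μ ≤ Q)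
    (hrt : 16 * (Fintype.card κ * r) ≤ t) :
    μ {ω | t ≤ ∑ a, (∑ j, (W j ω - vectorMean μ (W j)) a) ^ 2}
      ≤ ENNReal.ofReal (64 * Fintype.card κ * ρ / t ^ 2
        + 8 * (Fintype.card κ : ℝ) ^ 2 * Q / t ^ 2) := by
  classical
  set Z : κ → Ω → A → ℝ := fun j ω => W j ω - vectorMean μ (W j) with hZ
  have hZind : iIndepFun Z μ :=
    hind.comp (fun j v => v - vectorMean μ (W j)) (fun j => by fun_prop)
  have hZm (j : κ) : Measurable (Z j) := (hm j).sub_const _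
  have hZM (j : κ) (a : A) : HasAllMoments (fun ω => Z j ω a) μ :=
    hasAllMoments_sub_vectorMean (hM j) a
  have hU := integral_sq_sum_offDiag_le hZind hZm hZM
    (fun j a => integral_sub_vectorMean (hM j) a) hQ fun j k hjk =>
      (integral_sq_inner_sub_vectorMean_le (hind.indepFun hjk) (hM j) (hM k)).trans (hQW j k hjk)
  set U : Ω → ℝ := fun ω =>
    ∑ e ∈ (Finset.univ : Finset κ).offDiag, ∑ a, Z e.1 ω a * Z e.2 ω a with hUdef
  have hUM : HasAllMoments U μ := .sum fun e _ => .sum fun a _ => (hZM e.1 a).mul (hZM e.2 a)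
  set R : κ → Ω → ℝ := fun j ω => ∑ a, W j ω a ^ 2 with hRdef
  have hRM (j : κ) : HasAllMoments (R j) μ := .sum fun a _ => (hM j a).pow 2
  have hRind : iIndepFun R μ := hind.comp (fun _ v => ∑ a, v a ^ 2) (fun _ => by fun_prop)
  -- The squared norm of the mean is at most the mean squared norm, as variances are nonnegative.
  have hmean (j : κ) : ∑ a, vectorMean μ (W j) a ^ 2 ≤ r := by
    refine le_trans ?_ (hr j)
    rw [integral_finsetSum _ fun a _ => ((hM j a).pow 2).integrable]
    refine Finset.sum_le_sum fun a _ => ?_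
    have h1 := integral_mul_sub_vectorMean (hM j) a a
    have h2 : 0 ≤ ∫ ω, (W j ω - vectorMean μ (W j)) a * (W j ω - vectorMean μ (W j)) a ∂μ :=
      integral_nonneg fun ω => mul_self_nonneg _
    simp_rw [sq]
    linarith
  -- Off the first event the diagonal part is below `2 (t / 8) + 4 (card κ) r ≤ t / 2`, which is
  -- where the factor 16 in `hrt` is spent.
  have hsub : {ω | t ≤ ∑ a, (∑ j, Z j ω a) ^ 2}
      ⊆ {ω | t / 8 ≤ |(∑ j, R j) ω - ∫ ω', (∑ j, R j) ω' ∂μ|} ∪ {ω | t / 2 ≤ |U ω|} := by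
    intro ω hω
    simp only [Set.mem_ofPred_eq, Set.mem_union] at hω ⊢
    by_contra hcon
    push Not at hcon
    obtain ⟨h1, h2⟩ := hcon
    rw [sum_sq_sum_eq] at hω
    have hUω := (abs_lt.1 h2).2
    have hRω := (abs_lt.1 h1).2
    have hint : ∫ ω', (∑ j, R j) ω' ∂μ ≤ Fintype.card κ * r := by
      simp only [Finset.sum_apply]
      rw [integral_finsetSum _ fun j _ => (hRM j).integrable]
      refine (Finset.sum_le_sum fun j _ => hr j).trans ?_
      simp
    have hsq (j : κ) : ∑ a, Z j ω a ^ 2 ≤ 2 * R j ω + 2 * r := by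
      have : ∑ a, Z j ω a ^ 2 ≤ ∑ a, (2 * W j ω a ^ 2 + 2 * vectorMean μ (W j) a ^ 2) :=
        Finset.sum_le_sum fun a _ => by
          simp only [hZ, Pi.sub_apply]
          nlinarith [sq_nonneg (W j ω a + vectorMean μ (W j) a)]
      rw [Finset.sum_add_distrib, ← Finset.mul_sum, ← Finset.mul_sum] at this
      have := hmean j
      simp only [hRdef]
      linarith
    have hsum : ∑ j, ∑ a, Z j ω a ^ 2 ≤ 2 * (∑ j, R j) ω + 2 * (Fintype.card κ * r) := by
      refine (Finset.sum_le_sum fun j _ => hsq j).trans (le_of_eq ?_)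
      rw [Finset.sum_add_distrib, ← Finset.mul_sum]
      simp
      ring
    simp only [hUdef] at hUω
    linarith
  have hvar : Var[∑ j, R j; μ] ≤ Fintype.card κ * ρ := by
    rw [IndepFun.variance_sum (fun j _ => (hRM j).memLp_two)
      fun j _ k _ hjk => hRind.indepFun hjk]
    refine (Finset.sum_le_sum fun j _ => ?_).trans (b := ∑ _j : κ, ρ) (by simp)
    refine (variance_le_expectation_sq (hRM j).integrable.aestronglyMeasurable).trans ?_
    exact hρ j
  have hcheb : μ {ω | t / 8 ≤ |(∑ j, R j) ω - ∫ ω', (∑ j, R j) ω' ∂μ|}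
      ≤ ENNReal.ofReal (64 * Fintype.card κ * ρ / t ^ 2) := by
    have hmem : MemLp (∑ j, R j) 2 μ := by
      have := (HasAllMoments.sum (s := Finset.univ) fun j _ => hRM j).memLp_two
      convert this using 1
      ext; simp
    refine (meas_ge_le_variance_div_sq hmem (by positivity : 0 < t / 8)).trans
      (ENNReal.ofReal_le_ofReal ?_)
    calc Var[∑ j, R j; μ] / (t / 8) ^ 2 ≤ (Fintype.card κ * ρ) / (t / 8) ^ 2 := by gcongr
      _ = 64 * Fintype.card κ * ρ / t ^ 2 := by field_simp; ring
  have hUcheb : μ {ω | t / 2 ≤ |U ω|}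
      ≤ ENNReal.ofReal (8 * (Fintype.card κ : ℝ) ^ 2 * Q / t ^ 2) := by
    refine (measure_abs_ge_le (hUM.pow 2).integrable (by positivity : 0 < t / 2)).trans
      (ENNReal.ofReal_le_ofReal ?_)
    calc (∫ ω, U ω ^ 2 ∂μ) / (t / 2) ^ 2 ≤ (2 * (Fintype.card κ : ℝ) ^ 2 * Q) / (t / 2) ^ 2 := by
          gcongr
      _ = 8 * (Fintype.card κ : ℝ) ^ 2 * Q / t ^ 2 := by field_simp; ring
  refine (measure_mono hsub).trans ((measure_union_le _ _).trans ?_)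
  -- The sign of `ρ` can only be read off from `hρ` at some index.
  by_cases hκ : Nonempty κ
  · obtain ⟨j⟩ := hκ
    have hρ0 : 0 ≤ ρ := (integral_nonneg fun ω => sq_nonneg _).trans (hρ j)
    rw [ENNReal.ofReal_add (by positivity) (by positivity)]
    exact add_le_add hcheb hUcheb
  · have : IsEmpty κ := not_nonempty_iff.1 hκ
    simp only [Fintype.card_eq_zero, Nat.cast_zero, mul_zero, zero_mul, zero_div, ne_eq,
      OfNat.ofNat_ne_zero, not_false_eq_true, zero_pow, ENNReal.ofReal_zero, add_zero] at hcheb hUcheb ⊢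
    exact (add_le_add hcheb hUcheb).trans (by simp)

end QuadraticForms

/-! ### The gradient as a linear image of fourth tensor powers -/

section Gradient

variable {n p : ℕ}

theorem gradL4_apply (A : Matrix (Fin n) (Fin n) ℝ) (Y : Matrix (Fin n) (Fin p) ℝ)
    (a b : Fin n) : gradL4 A Y a b = 4 * ∑ j, (A * Y) a j ^ 3 * Y b j := by
  have hsingle (i : Fin n) (j : Fin p) :
      (Matrix.single a b (1 : ℝ) * Y) i j = if i = a then Y b j else 0 := by
    rcases eq_or_ne i a with rfl | h
    · simp
    · simp [h]
  have hfun (t : ℝ) : l4Pow ((A + t • Matrix.single a b (1 : ℝ)) * Y)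
      = ∑ i, ∑ j, ((A * Y) i j + t * (if i = a then Y b j else 0)) ^ 4 := by
    simp only [l4Pow, Matrix.add_mul, Matrix.smul_mul, Matrix.add_apply, Matrix.smul_apply,
      smul_eq_mul, hsingle]
  have hd : HasDerivAt (fun t : ℝ => l4Pow ((A + t • Matrix.single a b (1 : ℝ)) * Y))
      (∑ i, ∑ j, 4 * (A * Y) i j ^ 3 * (if i = a then Y b j else 0)) 0 := by
    simp_rw [hfun]
    refine HasDerivAt.fun_sum fun i _ => HasDerivAt.fun_sum fun j _ => ?_
    have h := (((hasDerivAt_id (0 : ℝ)).mul_const (if i = a then Y b j else 0)).const_add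
      ((A * Y) i j)).fun_pow 4
    simpa using h
  have h : gradL4 A Y a b = deriv (fun t : ℝ =>
      l4Pow ((A + t • Matrix.single a b (1 : ℝ)) * Y)) 0 := rfl
  rw [h, hd.deriv, Finset.sum_eq_single a (fun i _ hi => by simp [hi]) (by simp),
    Finset.mul_sum]
  exact Finset.sum_congr rfl fun j _ => by simp; ring

theorem frobenius_norm_sq (M : Matrix (Fin n) (Fin n) ℝ) : ‖M‖ ^ 2 = ∑ i, ∑ j, M i j ^ 2 := by
  rw [Matrix.frobenius_norm_def, ← Real.sqrt_eq_rpow, Real.sq_sqrt (by positivity)]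
  simp

/-- The fourth tensor power of a vector. -/
def tensorFour (x : Fin n → ℝ) (α : Fin 4 → Fin n) : ℝ := ∏ r, x (α r)

theorem prod_sum_four (V : Fin 4 → Fin n → ℝ) :
    ∏ r, ∑ k, V r k = ∑ α : Fin 4 → Fin n, ∏ r, V r (α r) := by
  rw [Finset.prod_univ_sum, Fintype.piFinset_univ]

theorem sum_tensorFour_mul (x y : Fin n → ℝ) :
    ∑ α, tensorFour x α * tensorFour y α = (∑ i, x i * y i) ^ 4 := by
  have := prod_sum_four fun _ i => x i * y i
  simp only [Finset.prod_const, Finset.card_univ, Fintype.card_fin] at this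
  rw [this]
  exact Finset.sum_congr rfl fun α _ => Finset.prod_mul_distrib.symm

/-- The tensor `w_a ⊗ w_a ⊗ w_a ⊗ d_b` built from rows of two matrices. -/
def rowTensor (W D : Matrix (Fin n) (Fin n) ℝ) (e : Fin n × Fin n) (α : Fin 4 → Fin n) : ℝ :=
  ∏ r, (![W e.1, W e.1, W e.1, D e.2] : Fin 4 → Fin n → ℝ) r (α r)

/-- This separates the orthogonal matrices from the randomness: a quartic in the column becomes
linear in its tensor power. -/
theorem pow_three_mul_eq_sum_rowTensor (W D : Matrix (Fin n) (Fin n) ℝ)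
    (X : Matrix (Fin n) (Fin p) ℝ) (a b : Fin n) (j : Fin p) :
    (W * X) a j ^ 3 * (D * X) b j
      = ∑ α, rowTensor W D (a, b) α * tensorFour (fun i => X i j) α := by
  have := prod_sum_four fun r k =>
    (![W a, W a, W a, D b] : Fin 4 → Fin n → ℝ) r k * X k j
  simp only [Finset.prod_mul_distrib] at this
  simp only [rowTensor, tensorFour]
  rw [← this]
  simp only [Fin.prod_univ_four, Matrix.mul_apply, Matrix.cons_val_zero, Matrix.cons_val_one,
    Matrix.cons_val]
  ring

/-- The inner product of elementary tensors factors as `⟨w_a, w_a'⟩ ^ 3 ⟨d_b, d_b'⟩`, and the rows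
of an orthogonal matrix are orthonormal. -/
theorem sum_rowTensor_mul {W D : Matrix (Fin n) (Fin n) ℝ}
    (hW : W ∈ Matrix.orthogonalGroup (Fin n) ℝ) (hD : D ∈ Matrix.orthogonalGroup (Fin n) ℝ)
    (e e' : Fin n × Fin n) :
    ∑ α, rowTensor W D e α * rowTensor W D e' α = if e = e' then 1 else 0 := by
  have hrow {M : Matrix (Fin n) (Fin n) ℝ} (hM : M ∈ Matrix.orthogonalGroup (Fin n) ℝ)
      (a b : Fin n) : ∑ k, M a k * M b k = if a = b then 1 else 0 := by
    have := congrFun (congrFun (Matrix.mem_orthogonalGroup_iff _ _ |>.1 hM) a) b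
    simpa [Matrix.mul_apply, Matrix.star_eq_conjTranspose, Matrix.one_apply] using this
  simp only [rowTensor, ← Finset.prod_mul_distrib]
  rw [← prod_sum_four fun r k => (![W e.1, W e.1, W e.1, D e.2] : Fin 4 → Fin n → ℝ) r k *
    (![W e'.1, W e'.1, W e'.1, D e'.2] : Fin 4 → Fin n → ℝ) r k]
  simp only [Fin.prod_univ_four, Matrix.cons_val_zero, Matrix.cons_val_one, Matrix.cons_val]
  rw [hrow hW, hrow hD]
  obtain ⟨a, b⟩ := e
  obtain ⟨a', b'⟩ := e'
  by_cases ha : a = a' <;> by_cases hb : b = b' <;> simp [ha, hb]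

/-- Bessel's inequality for the orthonormal row tensors. -/
theorem sum_sq_rowTensor_le {W D : Matrix (Fin n) (Fin n) ℝ}
    (hW : W ∈ Matrix.orthogonalGroup (Fin n) ℝ) (hD : D ∈ Matrix.orthogonalGroup (Fin n) ℝ)
    (S : (Fin 4 → Fin n) → ℝ) :
    ∑ a, ∑ b, (∑ α, rowTensor W D (a, b) α * S α) ^ 2 ≤ ∑ α, S α ^ 2 := by
  have hv : Orthonormal ℝ fun e : Fin n × Fin n =>
      (WithLp.toLp 2 (rowTensor W D e) : EuclideanSpace ℝ (Fin 4 → Fin n)) := by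
    rw [orthonormal_iff_ite]
    intro e e'
    rw [← sum_rowTensor_mul hW hD]
    simp [PiLp.inner_apply, mul_comm]
  have h := hv.sum_inner_products_le (WithLp.toLp 2 S : EuclideanSpace ℝ (Fin 4 → Fin n))
    (s := Finset.univ)
  rw [EuclideanSpace.norm_sq_eq, ← Finset.univ_product_univ, Finset.sum_product] at h
  simpa [PiLp.inner_apply, mul_comm] using h

end Gradient

namespace IsBernoulliGaussianMatrix

variable {Ω : Type*} [MeasurableSpace Ω] {μ : Measure Ω} [IsProbabilityMeasure μ] {n p : ℕ}
  {X : Ω → Matrix (Fin n) (Fin p) ℝ} {θ : unitInterval}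

theorem hasAllMoments_tensorFour (hX : IsBernoulliGaussianMatrix X θ μ) (j : Fin p)
    (α : Fin 4 → Fin n) : HasAllMoments (fun ω => tensorFour (fun i => X ω i j) α) μ :=
  .prod fun r _ => hX.hasAllMoments (α r) j

theorem gradL4_sub_matrixExpectation_apply (hX : IsBernoulliGaussianMatrix X θ μ)
    (A D : Matrix (Fin n) (Fin n) ℝ) (ω : Ω) (a b : Fin n) :
    (gradL4 A (D * X ω) - matrixExpectation μ (fun ω' => gradL4 A (D * X ω'))) a b
      = 4 * ∑ α, rowTensor (A * D) D (a, b) α * ∑ j, (tensorFour (fun i => X ω i j)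
        - vectorMean μ fun ω' => tensorFour (fun i => X ω' i j)) α := by
  have hg (ω : Ω) : gradL4 A (D * X ω) a b = 4 * ∑ j, ∑ α, rowTensor (A * D) D (a, b) α
      * tensorFour (fun i => X ω i j) α := by
    rw [gradL4_apply]
    simp only [← Matrix.mul_assoc, pow_three_mul_eq_sum_rowTensor]
  have hE : ∫ ω, gradL4 A (D * X ω) a b ∂μ = 4 * ∑ j, ∑ α, rowTensor (A * D) D (a, b) α
      * vectorMean μ (fun ω' => tensorFour (fun i => X ω' i j)) α := by
    have hi (j : Fin p) (α : Fin 4 → Fin n) : HasAllMoments (fun ω =>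
        rowTensor (A * D) D (a, b) α * tensorFour (fun i => X ω i j) α) μ :=
      (hX.hasAllMoments_tensorFour j α).const_mul _
    simp_rw [hg]
    rw [integral_const_mul, integral_finsetSum _ fun j _ =>
      (HasAllMoments.sum fun α _ => hi j α).integrable]
    congr 1
    refine Finset.sum_congr rfl fun j _ => ?_
    rw [integral_finsetSum _ fun α _ => (hi j α).integrable]
    refine Finset.sum_congr rfl fun α _ => ?_
    rw [integral_const_mul, vectorMean]
  rw [Matrix.sub_apply, hg]
  simp only [matrixExpectation, Matrix.of_apply]
  rw [hE, ← mul_sub, ← Finset.sum_sub_distrib]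
  congr 1
  simp_rw [← Finset.sum_sub_distrib, Finset.mul_sum]
  rw [Finset.sum_comm]
  refine Finset.sum_congr rfl fun α _ => Finset.sum_congr rfl fun j _ => ?_
  rw [Pi.sub_apply, mul_sub]

/-- The deviation of the gradient is controlled, uniformly over the orthogonal group, by the
deviation of the empirical fourth moment tensor. -/
theorem norm_gradL4_sub_matrixExpectation_sq_le (hX : IsBernoulliGaussianMatrix X θ μ)
    {A D : Matrix (Fin n) (Fin n) ℝ} (hA : A ∈ Matrix.orthogonalGroup (Fin n) ℝ)
    (hD : D ∈ Matrix.orthogonalGroup (Fin n) ℝ) (ω : Ω) :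
    ‖gradL4 A (D * X ω) - matrixExpectation μ (fun ω' => gradL4 A (D * X ω'))‖ ^ 2
      ≤ 16 * ∑ α, (∑ j, (tensorFour (fun i => X ω i j)
        - vectorMean μ fun ω' => tensorFour (fun i => X ω' i j)) α) ^ 2 := by
  rw [frobenius_norm_sq]
  simp_rw [hX.gradL4_sub_matrixExpectation_apply A D ω, mul_pow, ← Finset.mul_sum]
  have := sum_sq_rowTensor_le (mul_mem hA hD) hD fun α => ∑ j, (tensorFour (fun i => X ω i j)
        - vectorMean μ fun ω' => tensorFour (fun i => X ω' i j)) α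
  linarith

end IsBernoulliGaussianMatrix

/-! ### Numerical consequences of the sample size condition -/

/-- The absolute constant of the sample size condition. -/
noncomputable def sampleConst : ℝ := 2 ^ 80 * momentBound ^ 8

theorem le_sampleConst : 2 ^ 80 ≤ sampleConst := by
  have := one_le_pow₀ (n := 8) one_le_momentBound
  rw [sampleConst]; linarith

/-- The logarithm is used only through `log n ≥ 1 / 2` for `n ≥ 2`. The threshold supplies whatever
the sample condition misses, namely the case `n = 1` and lower bounds that do not degenerate as `θ →
0`. -/
theorem sample_size_bounds {θ δ C : ℝ} {n p : ℕ} (hθ : 0 < θ) (hθ1 : θ < 1) (hδ : 0 < δ)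
    (hC : 2 ≤ C) (hn : 1 ≤ n) (hp : 1 ≤ p)
    (hM : C / 2 * (1 / δ ^ 4 + 1 / δ ^ 2) ≤ max (n : ℝ) (p : ℝ))
    (hnp : C * (θ * (n : ℝ) ^ 2 * Real.log n / δ ^ 2) ≤ p) :
    C / 2 * (θ * (n : ℝ) ^ 2) ≤ p * δ ^ 2 ∧ C / 2 ≤ n * (p * δ ^ 2) ∧
      C / 2 * θ ≤ p * δ ^ 4 := by
  have hn' : (1 : ℝ) ≤ n := by exact_mod_cast hn
  have hp' : (1 : ℝ) ≤ p := by exact_mod_cast hp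
  have hlarge {x : ℝ} (hx : C / 2 * (1 / δ ^ 4 + 1 / δ ^ 2) ≤ x) :
      C / 2 ≤ x * δ ^ 2 ∧ C / 2 ≤ x * δ ^ 4 := by
    constructor
    · have h : C / 2 * (1 / δ ^ 2) ≤ x := le_trans (by gcongr; simp; positivity) hx
      rwa [mul_one_div, div_le_iff₀ (by positivity)] at h
    · have h : C / 2 * (1 / δ ^ 4) ≤ x := le_trans (by gcongr; simp; positivity) hx
      rwa [mul_one_div, div_le_iff₀ (by positivity)] at h
  have h2 : C / 2 ≤ n * (p * δ ^ 2) := by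
    refine (hlarge hM).1.trans ?_
    rw [← mul_assoc]
    refine mul_le_mul_of_nonneg_right (max_le ?_ ?_) (by positivity) <;> nlinarith
  have h1 : C / 2 * (θ * (n : ℝ) ^ 2) ≤ p * δ ^ 2 := by
    rcases (by omega : n = 1 ∨ 2 ≤ n) with rfl | hn2
    · simp only [Nat.cast_one, one_mul] at h2 ⊢
      nlinarith
    · have hlog : 1 / 2 ≤ Real.log n := by
        have := Real.log_two_gt_d9
        have h := Real.log_le_log (by norm_num) (by exact_mod_cast hn2 : (2 : ℝ) ≤ n)
        linarith
      rw [← mul_div_assoc, div_le_iff₀ (by positivity)] at hnp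
      refine le_trans ?_ hnp
      calc C / 2 * (θ * (n : ℝ) ^ 2) = C * (θ * (n : ℝ) ^ 2 * (1 / 2)) := by ring
        _ ≤ _ := by gcongr
  refine ⟨h1, h2, ?_⟩
  -- If `n` is the large dimension, then `n ^ 2 * δ ^ 2 ≥ 1` upgrades the first bound; if `p` is,
  -- the threshold suffices directly.
  rcases le_max_iff.1 hM with h | h
  · have hnδ := (hlarge h).1
    have h3 : 1 ≤ (n : ℝ) ^ 2 * δ ^ 2 := by nlinarith
    calc C / 2 * θ ≤ C / 2 * θ * ((n : ℝ) ^ 2 * δ ^ 2) := le_mul_of_one_le_right (by positivity) h3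
      _ = C / 2 * (θ * (n : ℝ) ^ 2) * δ ^ 2 := by ring
      _ ≤ p * δ ^ 2 * δ ^ 2 := by gcongr
      _ = _ := by ring
  · have := (hlarge h).2
    nlinarith

/-- Used with `N = n`, `s = p δ ^ 2`, `x = p δ ^ 4`. The conclusions are, in order, the hypothesis
`hrt` of the tail bound and the smallness of its diagonal and off-diagonal terms. -/
theorem moment_bounds {B θ s x N : ℝ} (hB : 1 ≤ B) (hθ : 0 < θ) (hθ1 : θ < 1) (hN : 1 ≤ N)
    (h1 : 2 ^ 80 * B ^ 8 / 2 * (θ * N ^ 2) ≤ s) (h2 : 2 ^ 80 * B ^ 8 / 2 ≤ N * s)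
    (h3 : 2 ^ 80 * B ^ 8 / 2 * θ ≤ x) :
    16 * (2 ^ 16 * (N * (B * θ)) * (1 + N * (B * θ)) ^ 3) ≤ N ^ 2 * s ∧
    128 * (2 ^ 64 * (N * (B * θ)) * (1 + N * (B * θ)) ^ 7) < N ^ 4 * s ^ 2 ∧
    16 * (2 ^ 64 * (N * (B * θ ^ 2)) * (1 + N * (B * θ ^ 2)) ^ 3) < N ^ 4 * x := by
  have hB0 : 0 < B := by linarith
  have hN0 : 0 < N := by linarith
  have hBN : 1 ≤ B * N := by nlinarith
  have hB48 : B ^ 4 ≤ B ^ 8 := pow_le_pow_right₀ hB (by norm_num)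
  have hs : 0 < s := lt_of_lt_of_le (by positivity) h1
  have hθN : N * (B * θ) ≤ B * N := by nlinarith [mul_pos hB0 hN0]
  have hθN2 : N * (B * θ ^ 2) ≤ B * N := by
    have : θ ^ 2 ≤ 1 := by nlinarith
    nlinarith [mul_pos hB0 hN0]
  refine ⟨?_, ?_, ?_⟩
  · calc 16 * (2 ^ 16 * (N * (B * θ)) * (1 + N * (B * θ)) ^ 3)
        ≤ 16 * (2 ^ 16 * (N * (B * θ)) * (2 * (B * N)) ^ 3) := by gcongr; linarith
      _ = 2 ^ 23 * B ^ 4 * (θ * N ^ 4) := by ring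
      _ ≤ 2 ^ 80 * B ^ 8 / 2 * (θ * N ^ 4) := by gcongr; nlinarith [pow_pos hB0 4]
      _ = N ^ 2 * (2 ^ 80 * B ^ 8 / 2 * (θ * N ^ 2)) := by ring
      _ ≤ N ^ 2 * s := by gcongr
  -- Up to constants the left side is `v + v ^ 8`. The linear term is paid for by the product of
  -- `h1` and `h2`, the eighth power by the square of `h1`.
  · set v := N * θ with hv
    have hv0 : 0 < v := by positivity
    have hvB : N * (B * θ) = B * v := by rw [hv]; ring
    have hconv : (1 + v) ^ 7 ≤ 2 ^ 7 * (1 + v ^ 7) := by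
      rcases le_total v 1 with h | h
      · calc (1 + v) ^ 7 ≤ (1 + 1) ^ 7 := by gcongr
          _ ≤ 2 ^ 7 * (1 + v ^ 7) := by nlinarith [pow_pos hv0 7]
      · calc (1 + v) ^ 7 ≤ (v + v) ^ 7 := by gcongr
          _ = 2 ^ 7 * v ^ 7 := by ring
          _ ≤ 2 ^ 7 * (1 + v ^ 7) := by nlinarith
    have hlow : 2 ^ 160 * B ^ 16 / 4 * v ≤ N ^ 4 * s ^ 2 := by
      calc 2 ^ 160 * B ^ 16 / 4 * v
          = (2 ^ 80 * B ^ 8 / 2) * (2 ^ 80 * B ^ 8 / 2 * (θ * N ^ 2)) * (1 / N) := by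
            rw [hv]; field_simp; ring
        _ ≤ (N * s) * s * (1 / N) := by gcongr
        _ = 1 * s ^ 2 := by field_simp
        _ ≤ N ^ 4 * s ^ 2 := by gcongr; exact one_le_pow₀ hN
    have hhigh : 2 ^ 160 * B ^ 16 / 4 * v ^ 8 ≤ N ^ 4 * s ^ 2 := by
      have hθ8 : θ ^ 8 ≤ θ ^ 2 := pow_le_pow_of_le_one hθ.le hθ1.le (by norm_num)
      calc 2 ^ 160 * B ^ 16 / 4 * v ^ 8 = 2 ^ 160 * B ^ 16 / 4 * (N ^ 8 * θ ^ 8) := by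
            rw [hv]; ring
        _ ≤ 2 ^ 160 * B ^ 16 / 4 * (N ^ 8 * θ ^ 2) := by gcongr
        _ = N ^ 4 * (2 ^ 80 * B ^ 8 / 2 * (θ * N ^ 2)) ^ 2 := by ring
        _ ≤ N ^ 4 * s ^ 2 := by gcongr
    have hpos : 0 < v + v ^ 8 := by positivity
    have hB816 : B ^ 8 ≤ B ^ 16 := pow_le_pow_right₀ hB (by norm_num)
    rw [hvB]
    calc 128 * (2 ^ 64 * (B * v) * (1 + B * v) ^ 7)
        ≤ 128 * (2 ^ 64 * (B * v) * (B * (1 + v)) ^ 7) := by gcongr; linarith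
      _ = 2 ^ 71 * B ^ 8 * v * (1 + v) ^ 7 := by ring
      _ ≤ 2 ^ 71 * B ^ 8 * v * (2 ^ 7 * (1 + v ^ 7)) := by gcongr
      _ = 2 ^ 78 * B ^ 8 * (v + v ^ 8) := by ring
      _ ≤ 2 ^ 78 * B ^ 16 * (v + v ^ 8) := by gcongr
      _ < 2 ^ 157 * B ^ 16 * (v + v ^ 8) := by gcongr <;> norm_num
      _ = (2 ^ 160 * B ^ 16 / 4 * v + 2 ^ 160 * B ^ 16 / 4 * v ^ 8) / 2 := by ring
      _ ≤ N ^ 4 * s ^ 2 := by linarith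
  · have hθ2 : θ ^ 2 ≤ θ := by nlinarith
    calc 16 * (2 ^ 64 * (N * (B * θ ^ 2)) * (1 + N * (B * θ ^ 2)) ^ 3)
        ≤ 16 * (2 ^ 64 * (N * (B * θ)) * (2 * (B * N)) ^ 3) := by gcongr; linarith
      _ = 2 ^ 71 * B ^ 4 * (N ^ 4 * θ) := by ring
      _ ≤ 2 ^ 71 * B ^ 8 * (N ^ 4 * θ) := by gcongr
      _ < 2 ^ 79 * B ^ 8 * (N ^ 4 * θ) := by gcongr <;> norm_num
      _ = N ^ 4 * (2 ^ 80 * B ^ 8 / 2 * θ) := by ring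
      _ ≤ N ^ 4 * x := by gcongr

/-! ### Deviation of the fourth moment tensor and conclusion -/

namespace IsBernoulliGaussianMatrix

variable {Ω : Type*} [MeasurableSpace Ω] {μ : Measure Ω} [IsProbabilityMeasure μ] {n p : ℕ}
  {X : Ω → Matrix (Fin n) (Fin p) ℝ} {θ : unitInterval}

theorem measure_tensorFour_deviation_lt_of_measurable (hX : IsBernoulliGaussianMatrix X θ μ)
    (hm : ∀ i j, Measurable fun ω => X ω i j) (hθ : 0 < θ) (hθ1 : θ < 1) {δ : ℝ} (hδ : 0 < δ)
    (hn : 1 ≤ n) (hp : 1 ≤ p)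
    (hM : sampleConst / 2 * (1 / δ ^ 4 + 1 / δ ^ 2) ≤ max (n : ℝ) (p : ℝ))
    (hnp : sampleConst * ((θ : ℝ) * (n : ℝ) ^ 2 * Real.log n / δ ^ 2) ≤ p) :
    μ {ω | (n * p * δ) ^ 2 ≤ ∑ α, (∑ j, (tensorFour (fun i => X ω i j)
        - vectorMean μ fun ω' => tensorFour (fun i => X ω' i j)) α) ^ 2}
      < ENNReal.ofReal (1 / (p : ℝ)) := by
  have hθ' : (0 : ℝ) < θ := hθ
  have hθ1' : (θ : ℝ) < 1 := hθ1
  have hB := one_le_momentBound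
  have hn' : (1 : ℝ) ≤ n := by exact_mod_cast hn
  have hp' : (1 : ℝ) ≤ p := by exact_mod_cast hp
  obtain ⟨h1, h2, h3⟩ := sample_size_bounds hθ' hθ1' hδ
    (le_trans (by norm_num) le_sampleConst) hn hp hM hnp
  rw [sampleConst] at h1 h2 h3
  obtain ⟨hi, hii, hiii⟩ := moment_bounds hB hθ' hθ1' hn' h1 h2 h3
  set r := 2 ^ 16 * (n * (momentBound * θ)) * (1 + n * (momentBound * θ)) ^ 3 with hr
  set ρ := 2 ^ 64 * (n * (momentBound * θ)) * (1 + n * (momentBound * θ)) ^ 7 with hρ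
  set Q := 2 ^ 64 * (n * (momentBound * θ ^ 2)) * (1 + n * (momentBound * θ ^ 2)) ^ 3 with hQ
  have hmeas : Measurable (tensorFour : (Fin n → ℝ) → _) := by
    unfold tensorFour; fun_prop
  have hnorm (j : Fin p) (ω : Ω) :
      ∑ α, tensorFour (fun i => X ω i j) α ^ 2 = (∑ i, X ω i j ^ 2) ^ 4 := by
    simp_rw [sq]
    exact sum_tensorFour_mul _ _
  have hmain := measure_sum_sq_sum_sub_vectorMean_ge_le (μ := μ)
    (W := fun j ω => tensorFour (fun i => X ω i j)) (r := r) (ρ := ρ) (Q := Q)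
    (t := (n * p * δ) ^ 2)
    ((hX.indep_columns hm).comp (fun _ => tensorFour) fun _ => hmeas)
    (fun j => hmeas.comp (measurable_pi_lambda _ fun i => hm i j))
    (fun j α => hX.hasAllMoments_tensorFour j α) (by positivity) (by positivity)
    (fun j => by
      simp_rw [hnorm]
      exact hX.integral_norm_sq_column_pow_le hm j (by norm_num) (by norm_num))
    (fun j => by
      simp_rw [hnorm, ← pow_mul]
      exact hX.integral_norm_sq_column_pow_le hm j (by norm_num) (by norm_num))
    (fun j k hjk => by
      simp_rw [sum_tensorFour_mul, ← pow_mul]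
      exact hX.integral_inner_columns_pow_le hm hjk)
    (by
      rw [Fintype.card_fin]
      calc 16 * (p * r) = p * (16 * r) := by ring
        _ ≤ p * (n ^ 2 * (p * δ ^ 2)) := by gcongr
        _ = _ := by ring)
  refine hmain.trans_lt ?_
  rw [Fintype.card_fin]
  refine (ENNReal.ofReal_lt_ofReal_iff (by positivity)).2 ?_
  -- Each of the two error terms takes half of `1 / p`.
  rw [← add_div, div_lt_div_iff₀ (by positivity) (by positivity)]
  calc (64 * p * ρ + 8 * (p : ℝ) ^ 2 * Q) * p
      = p ^ 2 * (128 * ρ) / 2 + p ^ 3 * (16 * Q) / 2 := by ring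
    _ < p ^ 2 * (n ^ 4 * (p * δ ^ 2) ^ 2) / 2 + p ^ 3 * (n ^ 4 * (p * δ ^ 4)) / 2 := by gcongr
    _ = 1 * ((n * p * δ) ^ 2) ^ 2 := by ring

/-- Tail bound for the deviation of the empirical fourth moment tensor of the columns. -/
theorem measure_tensorFour_deviation_lt (hX : IsBernoulliGaussianMatrix X θ μ)
    (hθ : 0 < θ) (hθ1 : θ < 1) {δ : ℝ} (hδ : 0 < δ) (hn : 1 ≤ n) (hp : 1 ≤ p)
    (hM : sampleConst / 2 * (1 / δ ^ 4 + 1 / δ ^ 2) ≤ max (n : ℝ) (p : ℝ))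
    (hnp : sampleConst * ((θ : ℝ) * (n : ℝ) ^ 2 * Real.log n / δ ^ 2) ≤ p) :
    μ {ω | (n * p * δ) ^ 2 ≤ ∑ α, (∑ j, (tensorFour (fun i => X ω i j)
        - vectorMean μ fun ω' => tensorFour (fun i => X ω' i j)) α) ^ 2}
      < ENNReal.ofReal (1 / (p : ℝ)) := by
  have hae (i : Fin n) (j : Fin p) := (hX.hasLaw i j).aemeasurable
  -- The entries are only almost everywhere measurable; a measurable modification changes neither
  -- the means nor the measure of the event.
  set X' : Ω → Matrix (Fin n) (Fin p) ℝ := fun ω => Matrix.of fun i j => (hae i j).mk _ ω with hX'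
  have hXX' (i : Fin n) (j : Fin p) : (fun ω => X ω i j) =ᵐ[μ] fun ω => X' ω i j :=
    (hae i j).ae_eq_mk
  have hall : ∀ᵐ ω ∂μ, ∀ i j, X ω i j = X' ω i j :=
    ae_all_iff.2 fun i => ae_all_iff.2 fun j => hXX' i j
  have hmean (j : Fin p) : (vectorMean μ fun ω => tensorFour (fun i => X ω i j))
      = vectorMean μ fun ω => tensorFour (fun i => X' ω i j) := by
    ext α
    refine integral_congr_ae ?_
    filter_upwards [hall] with ω hω
    simp only [hω]
  have hset : μ {ω | (n * p * δ) ^ 2 ≤ ∑ α, (∑ j, (tensorFour (fun i => X ω i j)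
        - vectorMean μ fun ω' => tensorFour (fun i => X ω' i j)) α) ^ 2}
      = μ {ω | (n * p * δ) ^ 2 ≤ ∑ α, (∑ j, (tensorFour (fun i => X' ω i j)
        - vectorMean μ fun ω' => tensorFour (fun i => X' ω' i j)) α) ^ 2} := by
    refine measure_congr ?_
    filter_upwards [hall] with ω hω
    refine propext ?_
    change _ ≤ _ ↔ _ ≤ _
    simp only [hω, hmean]
  rw [hset]
  exact (hX.congr hXX').measure_tensorFour_deviation_lt_of_measurable
    (fun i j => (hae i j).measurable_mk)
    hθ hθ1 hδ hn hp hM hnp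

end IsBernoulliGaussianMatrix

theorem proposition3p3 :
    ∃ C : ℝ, 0 < C ∧ ∃ k : ℕ, ∀ δ : ℝ, 0 < δ → ∃ M : ℝ, (δ ≤ 1 → M ≤ C / δ ^ k) ∧
      ∀ (θ : unitInterval), 0 < θ → θ < 1 →
      ∀ (n p : ℕ), 1 ≤ n → 1 ≤ p → M ≤ max (n : ℝ) (p : ℝ) →
        C * ((θ : ℝ) * (n : ℝ) ^ 2 * Real.log n / δ ^ 2) ≤ p →
      ∀ {Ω : Type*} [MeasurableSpace Ω] (μ : Measure Ω) [IsProbabilityMeasure μ]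
        (X : Ω → Matrix (Fin n) (Fin p) ℝ), IsBernoulliGaussianMatrix X θ μ →
      ∀ D ∈ Matrix.orthogonalGroup (Fin n) ℝ,
        μ {ω | ENNReal.ofReal δ ≤
            ⨆ A ∈ Matrix.orthogonalGroup (Fin n) ℝ,
              ENNReal.ofReal (1 / (4 * (n : ℝ) * (p : ℝ)) *
                ‖gradL4 A (D * X ω) - matrixExpectation μ (fun ω' => gradL4 A (D * X ω'))‖)}
          < ENNReal.ofReal (1 / (p : ℝ)) := by
  have hC : 0 < sampleConst := lt_of_lt_of_le (by norm_num) le_sampleConst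
  refine ⟨sampleConst, hC, 4, fun δ hδ =>
    ⟨sampleConst / 2 * (1 / δ ^ 4 + 1 / δ ^ 2), fun hδ1 => ?_, ?_⟩⟩
  · have h : 1 / δ ^ 2 ≤ 1 / δ ^ 4 :=
      one_div_le_one_div_of_le (by positivity) (pow_le_pow_of_le_one hδ.le hδ1 (by norm_num))
    calc sampleConst / 2 * (1 / δ ^ 4 + 1 / δ ^ 2)
        ≤ sampleConst / 2 * (1 / δ ^ 4 + 1 / δ ^ 4) := by gcongr
      _ = sampleConst / δ ^ 4 := by ring
  intro θ hθ hθ1 n p hn hp hM hnp Ω _ μ _ X hX D hD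
  -- Only an inclusion of events is needed, so measurability of the supremum never enters.
  refine lt_of_le_of_lt (measure_mono fun ω hω => ?_)
    (hX.measure_tensorFour_deviation_lt hθ hθ1 hδ hn hp hM hnp)
  have hn' : (1 : ℝ) ≤ n := by exact_mod_cast hn
  have hp' : (1 : ℝ) ≤ p := by exact_mod_cast hp
  simp only [Set.mem_ofPred_eq] at hω ⊢
  set T := ∑ α, (∑ j, (tensorFour (fun i => X ω i j)
    - vectorMean μ fun ω' => tensorFour (fun i => X ω' i j)) α) ^ 2 with hT
  have hT0 : 0 ≤ T := Finset.sum_nonneg fun α _ => sq_nonneg _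
  -- The bound by `√T` is free of `A`, so it passes to the supremum; the 4 from the gradient cancels
  -- the 4 in the normalization.
  have hbound : ENNReal.ofReal δ ≤ ENNReal.ofReal (Real.sqrt T / (n * p)) := by
    refine hω.trans (iSup₂_le fun A hA => ENNReal.ofReal_le_ofReal ?_)
    have h := Real.le_sqrt_of_sq_le (hX.norm_gradL4_sub_matrixExpectation_sq_le hA hD ω)
    rw [Real.sqrt_mul (by norm_num), (by norm_num : (16 : ℝ) = 4 ^ 2),
      Real.sqrt_sq (by norm_num)] at h
    rw [one_div_mul_eq_div, div_le_div_iff₀ (by positivity) (by positivity)]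
    refine (mul_le_mul_of_nonneg_right h (by positivity)).trans_eq ?_
    ring
  have h := (ENNReal.ofReal_le_ofReal_iff (by positivity)).1 hbound
  rw [le_div_iff₀ (by positivity)] at h
  calc ((n : ℝ) * p * δ) ^ 2 = (δ * (n * p)) ^ 2 := by ring
    _ ≤ Real.sqrt T ^ 2 := by gcongr
    _ = T := Real.sq_sqrt hT0
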